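/- All graphs are finite, simple and undirected. A decoder is a directed graph $D=(\Sigma,A)$ (loops allowed) on a finite alphabet $\Sigma$. A graph $G=(V,E)$ with $n$ vertices is a letter graph over $D$ if there are a map $\ell:V\to\Sigma$ and a bijection $c:V\to\{1,\dots,n\}$ such that any two vertices $x,y\in V$ are adjacent in $G$ if and only if either $(\ell(x),\ell(y))\in A$ and $c(x)<c(y)$, or $(\ell(y),\ell(x))\in A$ and $c(y)<c(x)$. A $k$-letter graph is a letter graph over some decoder with $|\Sigma|=k$, and the lettericity of $G$ is the least $k$ such that $G$ is a $k$-letter graph. An obstruction for $k$-lettericity is a graph $G$ of lettericity more than $k$ such that, for every vertex $v$ of $G$, the graph $G\setminus\{v\}$ has lettericity at most $k$. Theorem. There is a function $f:\mathbb{N}\to\mathbb{R}$ with $f(k)=O(k^2\log k)$ as $k\to\infty$ such that, for every positive integer $k$, every obstruction for $k$-lettericity has at most $2^{f(k)}$ vertices. -/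

import Mathlib

open Asymptotics Filter

/-- `(ℓ, c)` is a letter realisation of the graph `G` over the decoder `D` with alphabet `S`
(a directed graph on `S`, loops allowed): `ℓ` assigns letters to the vertices, and `c` numbers
the `n` vertices bijectively by `Fin n`. -/
def IsLetterRealisation {S V : Type*} (D : Digraph S) (G : SimpleGraph V)
    (ℓ : V → S) (c : V ≃ Fin (Nat.card V)) : Prop :=
  ∀ x y : V, G.Adj x y ↔
    (D.Adj (ℓ x) (ℓ y) ∧ c x < c y) ∨ (D.Adj (ℓ y) (ℓ x) ∧ c y < c x)

/-- `G` is a letter graph over the decoder `D`. -/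
def IsLetterGraphOver {S V : Type*} (D : Digraph S) (G : SimpleGraph V) : Prop :=
  ∃ (ℓ : V → S) (c : V ≃ Fin (Nat.card V)), IsLetterRealisation D G ℓ c

/-- `G` is a `k`-letter graph: a letter graph over some decoder whose alphabet has `k` letters. -/
def IsKLetterGraph {V : Type*} (k : ℕ) (G : SimpleGraph V) : Prop :=
  ∃ D : Digraph (Fin k), IsLetterGraphOver D G

/-- The lettericity of a (finite) graph: the least `k` such that it is a `k`-letter graph. -/
noncomputable def lettericity {V : Type*} (G : SimpleGraph V) : ℕ :=
  sInf {k : ℕ | IsKLetterGraph k G}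

/-- `G` is an obstruction for `k`-lettericity: it has lettericity more than `k`, and deleting any
vertex yields a graph of lettericity at most `k`. -/
def IsLettericityObstruction {V : Type*} (k : ℕ) (G : SimpleGraph V) : Prop :=
  k < lettericity G ∧ ∀ v : V, lettericity (G.induce {v}ᶜ) ≤ k

/-- Every finite graph is a letter graph, so the minimum defining the lettericity is attained. -/
theorem exists_isKLetterGraph {V : Type*} [Finite V] (G : SimpleGraph V) :
    ∃ k : ℕ, IsKLetterGraph k G := by
  let c := Finite.equivFin V
  refine ⟨Nat.card V, ⟨fun a b => G.Adj (c.symm a) (c.symm b)⟩, c, c, fun x y => ?_⟩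
  simp only [Equiv.symm_apply_apply]
  constructor
  · intro h
    rcases lt_or_gt_of_ne (c.injective.ne h.ne) with h1 | h1
    · exact Or.inl ⟨h, h1⟩
    · exact Or.inr ⟨h.symm, h1⟩
  · rintro (h | h)
    · exact h.1
    · exact h.1.symm

theorem IsKLetterGraph.mono {V : Type*} {G : SimpleGraph V} {k m : ℕ} (hkm : k ≤ m)
    (h : IsKLetterGraph k G) : IsKLetterGraph m G := by
  obtain ⟨D, ℓ, c, h⟩ := h
  refine ⟨⟨fun a b => ∃ i j : Fin k, Fin.castLE hkm i = a ∧ Fin.castLE hkm j = b ∧ D.Adj i j⟩,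
    fun x => Fin.castLE hkm (ℓ x), c, fun x y => ?_⟩
  simp [h x y, Fin.castLE_inj]

/-- A finite graph has lettericity at most `k` exactly when it is a `k`-letter graph. -/
theorem lettericity_le_iff {V : Type*} [Finite V] {G : SimpleGraph V} {k : ℕ} :
    lettericity G ≤ k ↔ IsKLetterGraph k G :=
  ⟨fun h => IsKLetterGraph.mono h (Nat.sInf_mem (exists_isKLetterGraph G)),
    fun h => Nat.sInf_le h⟩

/-! Fix an encoding of `G - v₀` and list the vertices as `v₀`, then in its order. Vertices of an
initial segment sharing a letter there look alike to every later vertex; `v₀` forms a class of its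
own. Thus what an encoding of a segment must respect to be glued to the rest is captured by a
configuration: the decoder and, for each pair (class, new letter), an interval of zones. If every
configuration compatible with the segment before `v` stayed compatible after adding `v`, an encoding
of `G - v` could be repaired into one of `G` (`isKLetterGraph_of_forall_compatible`). So each `v`
has a configuration that is lost exactly when `v` is added. Compatibility passes to subsets, so
these are distinct, and there are only `2 ^ O(k ^ 2 log k)` configurations. -/

/-- `ℓ` and the (not necessarily injective) position map `c` encode the adjacency of `G` between
vertices of `P` by the decoder `D`. -/
def EncodesOn {S V α : Type*} [LT α] (D : S → S → Prop) (G : SimpleGraph V) (ℓ : V → S)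
    (c : V → α) (P : Set V) : Prop :=
  ∀ x ∈ P, ∀ y ∈ P, G.Adj x y ↔ (D (ℓ x) (ℓ y) ∧ c x < c y) ∨ (D (ℓ y) (ℓ x) ∧ c y < c x)

theorem isKLetterGraph_of_encodesOn {V α : Type*} [Finite V] [LinearOrder α] {k : ℕ}
    {G : SimpleGraph V} {D : Fin k → Fin k → Prop} {ℓ : V → Fin k} {c : V → α}
    (hc : Function.Injective c) (h : EncodesOn D G ℓ c Set.univ) : IsKLetterGraph k G := by
  have := Fintype.ofFinite V
  let _ : LinearOrder V := LinearOrder.lift' c hc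
  let e : V ≃o Fin (Nat.card V) :=
    (Fintype.orderIsoFinOfCardEq V (Nat.card_eq_fintype_card (α := V)).symm).symm
  have he : ∀ x y, e x < e y ↔ c x < c y := fun x y => e.lt_iff_lt
  refine ⟨⟨D⟩, ℓ, e.toEquiv, fun x y => ?_⟩
  rw [h x trivial y trivial, ← he, ← he]
  rfl

theorem exists_encodesOn_of_induce_compl {V : Type*} {k : ℕ} (hk : 1 ≤ k) {G : SimpleGraph V}
    {v : V} (h : IsKLetterGraph k (G.induce {v}ᶜ)) :
    ∃ (D : Fin k → Fin k → Prop) (ℓ : V → Fin k) (c : V → ℕ),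
      Set.InjOn c {v}ᶜ ∧ EncodesOn D G ℓ c {v}ᶜ := by
  classical
  obtain ⟨D, ℓ, c, h⟩ := h
  refine ⟨D.Adj, fun x => if hx : x ∈ ({v}ᶜ : Set V) then ℓ ⟨x, hx⟩ else ⟨0, hk⟩,
    fun x => if hx : x ∈ ({v}ᶜ : Set V) then c ⟨x, hx⟩ else 0, fun x hx y hy hxy => ?_,
    fun x hx y hy => ?_⟩
  · simp only [dif_pos hx, dif_pos hy] at hxy
    exact congrArg Subtype.val (c.injective (Fin.val_injective hxy))
  · simp only [dif_pos hx, dif_pos hy, Fin.val_fin_lt]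
    exact h ⟨x, hx⟩ ⟨y, hy⟩

/-! ### Zones and configurations -/

/-- A decoder on `Fin k` together with, for every class in `K × Fin k`, the two ends of an interval
of zones. -/
abbrev ZoneConfig (K : Type*) (k z : ℕ) : Type _ :=
  (Fin k → Fin k → Prop) × (K × Fin k → Fin z × Fin z)

/-- The subgraph on `P` has an encoding over the decoder of `κ`, with positions divided into zones,
in which every vertex `x` lies in the zones that `κ` allows for the class `(lam x, ℓ x)`. -/
def ZoneConfig.Compatible {V K : Type*} {k z : ℕ} (κ : ZoneConfig K k z) (G : SimpleGraph V)
    (lam : V → K) (P : Set V) : Prop :=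
  ∃ (ℓ : V → Fin k) (c : V → ℕ ×ₗ ℕ), Set.InjOn c P ∧ EncodesOn κ.1 G ℓ c P ∧
    ∀ x ∈ P, (κ.2 (lam x, ℓ x)).1 ≤ (ofLex (c x)).1 ∧ (ofLex (c x)).1 ≤ (κ.2 (lam x, ℓ x)).2

theorem ZoneConfig.Compatible.anti {V K : Type*} {k z : ℕ} {κ : ZoneConfig K k z}
    {G : SimpleGraph V} {lam : V → K} {P Q : Set V} (hPQ : P ⊆ Q) (h : κ.Compatible G lam Q) :
    κ.Compatible G lam P := by
  obtain ⟨ℓ, c, h1, h2, h3⟩ := h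
  exact ⟨ℓ, c, h1.mono hPQ, fun x hx y hy => h2 x (hPQ hx) y (hPQ hy), fun x hx => h3 x (hPQ hx)⟩

/-- The number of elements of `E` placed before `v`. -/
def zone {V : Type*} (E : Finset V) (c : V → ℕ) (v : V) : ℕ :=
  (E.filter fun e => c e < c v).card

theorem zone_mono {V : Type*} (E : Finset V) {c : V → ℕ} {u v : V} (h : c u ≤ c v) :
    zone E c u ≤ zone E c v :=
  Finset.card_le_card fun e he => by
    simp only [Finset.mem_filter] at he ⊢
    exact ⟨he.1, he.2.trans_le h⟩

theorem zone_lt_zone {V : Type*} {E : Finset V} {c : V → ℕ} {u v : V} (hu : u ∈ E)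
    (h : c u < c v) : zone E c u < zone E c v := by
  refine Finset.card_lt_card ((Finset.ssubset_iff_of_subset fun e he => ?_).2 ⟨u, ?_, ?_⟩)
  · simp only [Finset.mem_filter] at he ⊢
    exact ⟨he.1, he.2.trans h⟩
  · simp [hu, h]
  · simp

theorem toLex_zone_lt_iff {V : Type*} (E : Finset V) {c : V → ℕ} {u v : V} :
    toLex (zone E c u, c u) < toLex (zone E c v, c v) ↔ c u < c v := by
  rw [Prod.Lex.toLex_lt_toLex]
  constructor
  · rintro (h | h)
    · by_contra! h'
      exact absurd (zone_mono E h') (not_le.2 h)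
    · exact h.2
  · intro h
    rcases (zone_mono E h.le).lt_or_eq with h' | h'
    · exact Or.inl h'
    · exact Or.inr ⟨h', h⟩

/-- Replacing the part `P` of an encoding of `G - x` by a compatible encoding of `P ∪ {x}`. -/
theorem isKLetterGraph_of_forall_compatible {V K : Type*} [Finite V] [Fintype K] {k z : ℕ}
    (hz : Fintype.card K * k + 2 ≤ z) {G : SimpleGraph V} {lam : V → K} {P : Set V} {x : V}
    (hxP : x ∉ P)
    (hcut : ∀ a ∈ insert x P, ∀ b ∈ insert x P, lam a = lam b → ∀ y ∉ insert x P,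
      (G.Adj a y ↔ G.Adj b y))
    (hS : ∀ κ : ZoneConfig K k z, κ.Compatible G lam P → κ.Compatible G lam (insert x P))
    {D : Fin k → Fin k → Prop} {ℓ : V → Fin k} {c : V → ℕ} (hc : Set.InjOn c {x}ᶜ)
    (hD : EncodesOn D G ℓ c {x}ᶜ) : IsKLetterGraph k G := by
  classical
  have hPx : P ⊆ {x}ᶜ := fun y hy hyx => hxP (hyx ▸ hy)
  have hext : ∀ i : K × Fin k, ∃ p : V × V, (∃ v ∈ P, (lam v, ℓ v) = i) →
      (p.1 ∈ P ∧ (lam p.1, ℓ p.1) = i) ∧ (p.2 ∈ P ∧ (lam p.2, ℓ p.2) = i) ∧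
      ∀ v ∈ P, (lam v, ℓ v) = i → c p.1 ≤ c v ∧ c v ≤ c p.2 := by
    intro i
    by_cases h : ∃ v ∈ P, (lam v, ℓ v) = i
    · have hne : {v | v ∈ P ∧ (lam v, ℓ v) = i}.Nonempty := h
      obtain ⟨p, hp, hp'⟩ := Set.exists_min_image _ c (Set.toFinite _) hne
      obtain ⟨q, hq, hq'⟩ := Set.exists_max_image _ c (Set.toFinite _) hne
      exact ⟨(p, q), fun _ => ⟨hp, hq, fun v hv hvi => ⟨hp' v ⟨hv, hvi⟩, hq' v ⟨hv, hvi⟩⟩⟩⟩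
    · exact ⟨(x, x), fun h' => absurd h' h⟩
  choose p hp using hext
  -- Cutting at the last vertex of each class suffices: the tie-break in `c₁` handles the first
  -- vertices.
  let E : Finset V := Finset.univ.image fun i => (p i).2
  have hME : ∀ i, (p i).2 ∈ E := fun i =>
    Finset.mem_image_of_mem _ (Finset.mem_univ i)
  have hEcard : E.card ≤ Fintype.card K * k := by
    simpa using Finset.card_image_le (s := Finset.univ) (f := fun i => (p i).2)
  have hzone : ∀ v, zone E c v < z := fun v => by
    have : zone E c v ≤ E.card := Finset.card_filter_le _ _
    omega
  -- A class absent from `P` gets the empty interval from 1 to 0, so the new encoding cannot use it.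
  let κ : ZoneConfig K k z := (D, fun i => if ∃ v ∈ P, (lam v, ℓ v) = i then
    (⟨zone E c (p i).1, hzone _⟩, ⟨zone E c (p i).2, hzone _⟩) else (⟨1, by omega⟩, ⟨0, by omega⟩))
  have hκ : κ.Compatible G lam P := by
    refine ⟨ℓ, fun v => toLex (zone E c v, c v), fun u hu v hv huv => ?_, fun u hu v hv => ?_,
      fun v hv => ?_⟩
    · exact hc (hPx hu) (hPx hv) (congrArg (fun t => (ofLex t).2) huv)
    · simp only [toLex_zone_lt_iff]
      exact hD u (hPx hu) v (hPx hv)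
    · have hi : ∃ u ∈ P, (lam u, ℓ u) = (lam v, ℓ v) := ⟨v, hv, rfl⟩
      have h := (hp _ hi).2.2 v hv rfl
      simp only [κ, if_pos hi, ofLex_toLex]
      exact ⟨zone_mono E h.1, zone_mono E h.2⟩
  obtain ⟨ℓ', c', hinj, henc, hzo⟩ := hS κ hκ
  let ℓ₁ : V → Fin k := fun v => if v ∈ insert x P then ℓ' v else ℓ v
  -- Within a zone, outside vertices (tag 0) precede those of `insert x P` (tag 1).
  let c₁ : V → ℕ ×ₗ ℕ ×ₗ ℕ := fun v => if v ∈ insert x P then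
    toLex ((ofLex (c' v)).1, toLex (1, (ofLex (c' v)).2)) else toLex (zone E c v, toLex (0, c v))
  have hin : ∀ u ∈ insert x P, ∀ v ∈ insert x P, (c₁ u < c₁ v ↔ c' u < c' v) := by
    intro u hu v hv
    simp only [c₁, if_pos hu, if_pos hv, Prod.Lex.lt_iff, ofLex_toLex, lt_irrefl, true_and,
      false_or]
  have hout : ∀ u ∉ insert x P, ∀ v ∉ insert x P, (c₁ u < c₁ v ↔ c u < c v) := by
    intro u hu v hv
    rw [← toLex_zone_lt_iff E]
    simp only [c₁, if_neg hu, if_neg hv, Prod.Lex.toLex_lt_toLex, lt_irrefl, true_and, false_or]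
  have hnx : ∀ y ∉ insert x P, y ∈ ({x}ᶜ : Set V) := fun y hy h => hy (Or.inl h)
  have hmix : ∀ a ∈ insert x P, ∀ y ∉ insert x P, c₁ a ≠ c₁ y ∧
      (G.Adj a y ↔ (D (ℓ₁ a) (ℓ₁ y) ∧ c₁ a < c₁ y) ∨ (D (ℓ₁ y) (ℓ₁ a) ∧ c₁ y < c₁ a)) := by
    intro a ha y hy
    have hne : c₁ a ≠ c₁ y := by
      intro h
      simp only [c₁, if_pos ha, if_neg hy] at h
      exact one_ne_zero (congrArg (fun t => (ofLex (ofLex t).2).1) h)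
    refine ⟨hne, ?_⟩
    obtain ⟨hlo, hhi⟩ := hzo a ha
    by_cases hi : ∃ u ∈ P, (lam u, ℓ u) = (lam a, ℓ' a)
    swap
    · simp only [κ, if_neg hi] at hlo hhi
      omega
    simp only [κ, if_pos hi] at hlo hhi
    obtain ⟨⟨hm, hmi⟩, ⟨hM, hMi⟩, -⟩ := hp _ hi
    set m := (p (lam a, ℓ' a)).1
    have hME := hME (lam a, ℓ' a)
    set M := (p (lam a, ℓ' a)).2
    rw [Prod.mk.injEq] at hmi hMi
    have adj_m : G.Adj a y ↔ G.Adj m y := hcut a ha m (Or.inr hm) hmi.1.symm y hy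
    have adj_M : G.Adj a y ↔ G.Adj M y := hcut a ha M (Or.inr hM) hMi.1.symm y hy
    rw [hD m (hPx hm) y (hnx y hy), hmi.2] at adj_m
    rw [hD M (hPx hM) y (hnx y hy), hMi.2] at adj_M
    have hcm : c m ≠ c y := fun h => hy (hc (hPx hm) (hnx y hy) h ▸ Or.inr hm)
    have hcM : c M ≠ c y := fun h => hy (hc (hPx hM) (hnx y hy) h ▸ Or.inr hM)
    have h1 : c M < c y → c₁ a < c₁ y := fun h => by
      simp only [c₁, if_pos ha, if_neg hy, Prod.Lex.toLex_lt_toLex]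
      exact Or.inl (hhi.trans_lt (zone_lt_zone hME h))
    have h2 : c y < c m → c₁ y < c₁ a := fun h => by
      simp only [c₁, if_pos ha, if_neg hy, Prod.Lex.toLex_lt_toLex]
      rcases ((zone_mono E h.le).trans hlo).lt_or_eq with h' | h'
      · exact Or.inl h'
      · exact Or.inr ⟨h', Or.inl one_pos⟩
    have e1 : ℓ₁ a = ℓ' a := if_pos ha
    have e2 : ℓ₁ y = ℓ y := if_neg hy
    rw [e1, e2]
    rcases lt_or_gt_of_ne hcM with hMy | hMy
    · have h := h1 hMy
      simpa [h, h.not_gt, hMy, hMy.not_gt] using adj_M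
    rcases lt_or_gt_of_ne hcm with hmy | hmy
    -- Now `y` lies between `m` and `M`, to which it is adjacent alike. Hence `D` relates the two
    -- letters in both directions or in neither, and the order of `a` and `y` is irrelevant.
    · simp only [hMy, hMy.not_gt, and_true, and_false, false_or] at adj_M
      simp only [hmy, hmy.not_gt, and_true, and_false, or_false] at adj_m
      rcases lt_or_gt_of_ne hne with h | h
      · simpa [h, h.not_gt] using adj_m
      · simpa [h, h.not_gt] using adj_M
    · have h := h2 hmy
      simpa [h, h.not_gt, hmy, hmy.not_gt] using adj_m
  refine isKLetterGraph_of_encodesOn (D := D) (ℓ := ℓ₁) (c := c₁) (fun u v huv => ?_)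
    (fun u _ v _ => ?_)
  · by_cases hu : u ∈ insert x P <;> by_cases hv : v ∈ insert x P
    · refine hinj hu hv (le_antisymm (not_lt.1 fun h => ?_) (not_lt.1 fun h => ?_))
      · exact ((hin v hv u hu).2 h).ne' huv
      · exact ((hin u hu v hv).2 h).ne huv
    · exact absurd huv (hmix u hu v hv).1
    · exact absurd huv.symm (hmix v hv u hu).1
    · refine hc (hnx u hu) (hnx v hv) (le_antisymm (not_lt.1 fun h => ?_) (not_lt.1 fun h => ?_))
      · exact ((hout v hv u hu).2 h).ne' huv
      · exact ((hout u hu v hv).2 h).ne huv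
  · by_cases hu : u ∈ insert x P <;> by_cases hv : v ∈ insert x P
    · simp only [hin u hu v hv, hin v hv u hu, ℓ₁, if_pos hu, if_pos hv]
      exact henc u hu v hv
    · exact (hmix u hu v hv).2
    · rw [G.adj_comm, or_comm]
      exact (hmix v hv u hu).2
    · simp only [hout u hu v hv, hout v hv u hu, ℓ₁, if_neg hu, if_neg hv]
      exact hD u (hnx u hu) v (hnx v hv)

/-! ### Counting configurations -/

/-- An obstruction has at most as many vertices as there are configurations. -/
theorem IsLettericityObstruction.card_le {V : Type*} [Finite V] {G : SimpleGraph V} {k : ℕ}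
    (hk : 1 ≤ k) (h : IsLettericityObstruction k G) :
    Nat.card V ≤ Nat.card (ZoneConfig (Option (Fin k)) k ((k + 1) * k + 2)) := by
  classical
  rcases isEmpty_or_nonempty V with hV | ⟨⟨v₀⟩⟩
  · simp
  have hdel : ∀ v, ∃ (D : Fin k → Fin k → Prop) (ℓ : V → Fin k) (c : V → ℕ),
      Set.InjOn c {v}ᶜ ∧ EncodesOn D G ℓ c {v}ᶜ := fun v =>
    exists_encodesOn_of_induce_compl hk (lettericity_le_iff.1 (h.2 v))
  have hG : ¬ IsKLetterGraph k G := fun h' => (lettericity_le_iff.2 h').not_gt h.1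
  obtain ⟨D₀, ℓ₀, c₀, hc₀, hD₀⟩ := hdel v₀
  -- Coming first, `v₀` lies in every segment `insert v {u | pos u < pos v}`, so each outside vertex
  -- is encoded by `c₀`.
  let pos : V → ℕ := fun v => if v = v₀ then 0 else c₀ v + 1
  let lam : V → Option (Fin k) := fun v => if v = v₀ then none else some (ℓ₀ v)
  have hpos : Function.Injective pos := by
    intro u v huv
    by_cases hu : u = v₀ <;> by_cases hv : v = v₀ <;> simp [pos, hu, hv] at huv ⊢
    exact hc₀ hu hv huv
  have hkey : ∀ v, ∃ κ : ZoneConfig (Option (Fin k)) k ((k + 1) * k + 2),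
      κ.Compatible G lam {u | pos u < pos v} ∧
      ¬ κ.Compatible G lam (insert v {u | pos u < pos v}) := by
    intro v
    by_contra! hcon
    obtain ⟨D, ℓ, c, hc, hD⟩ := hdel v
    refine hG (isKLetterGraph_of_forall_compatible (by simp) (by simp) ?_ hcon hc hD)
    intro a ha b hb hab y hy
    have hle : ∀ a ∈ insert v {u | pos u < pos v}, pos a ≤ pos v := by
      rintro a (rfl | ha)
      · exact le_rfl
      · exact le_of_lt ha
    have hvy : pos v < pos y := by
      rw [Set.mem_insert_iff, not_or] at hy
      exact lt_of_le_of_ne (not_lt.1 hy.2) fun h => hy.1 (hpos h).symm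
    have hay := (hle a ha).trans_lt hvy
    have hby := (hle b hb).trans_lt hvy
    have hy₀ : y ≠ v₀ := by
      rintro rfl
      simp [pos] at hvy
    by_cases hav : a = v₀ <;> by_cases hbv : b = v₀ <;> simp [lam, hav, hbv] at hab
    · rw [hav, hbv]
    · simp only [pos, if_neg hav, if_neg hbv, if_neg hy₀, add_lt_add_iff_right] at hay hby
      rw [hD₀ a hav y hy₀, hD₀ b hbv y hy₀, hab]
      simp [hay, hby, hay.not_gt, hby.not_gt]
  choose κ hκ hκ' using hkey
  -- The segment before `v` already contains `u`, so `κ v` survives adding `u` while `κ u` does not.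
  have hne : ∀ u v, pos u < pos v → κ u ≠ κ v := by
    intro u v huv he
    refine hκ' u (he ▸ (hκ v).anti ?_)
    rintro w (rfl | hw)
    · exact huv
    · exact lt_trans hw huv
  refine Nat.card_le_card_of_injective κ fun u v he => ?_
  by_contra huv
  rcases lt_or_gt_of_ne (hpos.ne huv) with h' | h'
  · exact hne u v h' he
  · exact hne v u h' he.symm

theorem card_zoneConfig (k z : ℕ) : Nat.card (ZoneConfig (Option (Fin k)) k z) =
    2 ^ (k * k) * (z * z) ^ ((k + 1) * k) := by
  classical
  simp [Nat.card_eq_fintype_card, ← pow_mul]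

theorem card_zoneConfig_le_pow {k : ℕ} (hk : 2 ≤ k) :
    Nat.card (ZoneConfig (Option (Fin k)) k ((k + 1) * k + 2)) ≤ k ^ (17 * k ^ 2) := by
  have hz : (k + 1) * k + 2 ≤ k ^ 4 := by
    nlinarith [Nat.mul_le_mul hk hk, Nat.mul_le_mul (Nat.mul_le_mul hk hk) (Nat.mul_le_mul hk hk)]
  have hm : (k + 1) * k ≤ 2 * k ^ 2 := by nlinarith
  rw [card_zoneConfig]
  calc 2 ^ (k * k) * (((k + 1) * k + 2) * ((k + 1) * k + 2)) ^ ((k + 1) * k)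
      ≤ k ^ (k * k) * (k ^ 4 * k ^ 4) ^ (2 * k ^ 2) := by
        refine Nat.mul_le_mul (Nat.pow_le_pow_left hk _) ?_
        exact (Nat.pow_le_pow_left (Nat.mul_le_mul hz hz) _).trans
          (Nat.pow_le_pow_right (by positivity) hm)
    -- The exponent is `1 + 8 * 2` times `k ^ 2`.
    _ = k ^ (17 * k ^ 2) := by
        rw [← pow_add, ← pow_mul, ← pow_add]
        congr 1
        ring

theorem mainTheorem1 :
    ∃ f : ℕ → ℝ, f =O[atTop] (fun k : ℕ => (k : ℝ) ^ 2 * Real.log (k : ℝ)) ∧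
      ∀ k : ℕ, 1 ≤ k → ∀ (V : Type*) [Finite V] (G : SimpleGraph V),
        IsLettericityObstruction k G → (Nat.card V : ℝ) ≤ (2 : ℝ) ^ f k := by
  have hpos : ∀ k : ℕ,
      0 < Nat.card (ZoneConfig (Option (Fin k)) k ((k + 1) * k + 2)) := fun k => by
    rw [card_zoneConfig]
    positivity
  refine ⟨fun k => Real.logb 2
    (Nat.card (ZoneConfig (Option (Fin k)) k ((k + 1) * k + 2))), ?_, ?_⟩
  · refine IsBigO.of_bound (17 / Real.log 2) ?_
    filter_upwards [eventually_ge_atTop 2] with k hk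
    have h2 : 0 < Real.log 2 := Real.log_pos one_lt_two
    have hlk : 0 ≤ Real.log k := Real.log_natCast_nonneg k
    have h1 : (1 : ℝ) ≤ Nat.card (ZoneConfig (Option (Fin k)) k ((k + 1) * k + 2)) := by
      exact_mod_cast hpos k
    rw [Real.norm_of_nonneg (Real.logb_nonneg one_lt_two h1), Real.norm_of_nonneg (by positivity),
      Real.logb, div_mul_eq_mul_div]
    refine div_le_div_of_nonneg_right ?_ h2.le
    calc Real.log (Nat.card (ZoneConfig (Option (Fin k)) k ((k + 1) * k + 2)))
        ≤ Real.log ((k : ℝ) ^ (17 * k ^ 2)) := by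
          refine Real.log_le_log (by linarith) ?_
          exact_mod_cast card_zoneConfig_le_pow hk
      _ = 17 * ((k : ℝ) ^ 2 * Real.log k) := by
          rw [Real.log_pow]
          push_cast
          ring
  · intro k hk V _ G hG
    rw [Real.rpow_logb two_pos (by norm_num) (by exact_mod_cast hpos k)]
    exact_mod_cast hG.card_le hk
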